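/- For positive integers $p,q,r$ let $G(p;q;r)$ (Oka's group) be the group with generators $\omega$ and $a_i$ $(i\in\mathbb{Z})$ and relations $\omega=a_{p-1}a_{p-2}\cdots a_1a_0$, $\omega^r=1$, $a_i=a_{i+q}$ for all $i\in\mathbb{Z}$, and $a_{i+p}=\omega a_i\omega^{-1}$ for all $i\in\mathbb{Z}$. Let $p,q,r$ be positive integers, let $s=\gcd(p,q)$ and let $a=\gcd\left(\frac{q}{s},r\right)$. Then $$G(p;q;r)\cong G(p;as;r)\cong G\left(as;p;\frac{r}{a}\cdot\frac{p}{s}\right).$$ In particular, there are positive integers $p',q',r'$ with $G(p;q;r)\cong G(p';q';r')$, $p'\geq q'$ and $\frac{q'}{\gcd(p',q')}\mid r'$; namely, $(p',q',r')$ can be taken to be one of $(p,as,r)$ and $\left(as,p,\frac{r}{a}\cdot\frac{p}{s}\right)$. Moreover, if $G(p;q;r)$ is not a finite cyclic group, then there is exactly one triple $(p',q',r')$ of positive integers with $G(p;q;r)\cong G(p';q';r')$, $p'\geq q'$ and $\frac{q'}{\gcd(p',q')}\mid r'$. -/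

import Mathlib

/-- The generating symbols of Oka's group: `ω` and `a i` for `i : ℤ`. -/
inductive OkaGen : Type
  | ω : OkaGen
  | a (i : ℤ) : OkaGen

namespace OkaGen

/-- The generator `ω` as an element of the free group. -/
def fω : FreeGroup OkaGen := FreeGroup.of OkaGen.ω

/-- The generator `a i` as an element of the free group. -/
def fa (i : ℤ) : FreeGroup OkaGen := FreeGroup.of (OkaGen.a i)

/-- The word `a (p-1) * a (p-2) * ⋯ * a 1 * a 0`. -/
def descProd (p : ℕ) : FreeGroup OkaGen :=
  ((List.range p).reverse.map fun j : ℕ => fa (j : ℤ)).prod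

end OkaGen

/-- The relators of Oka's group: a relation `u = v` is recorded as the relator `u * v⁻¹`. -/
inductive OkaRel (p q r : ℕ) : FreeGroup OkaGen → Prop
  /-- `ω = a (p-1) * ⋯ * a 0` -/
  | omega_eq : OkaRel p q r (OkaGen.fω * (OkaGen.descProd p)⁻¹)
  /-- `ω ^ r = 1` -/
  | omega_pow : OkaRel p q r (OkaGen.fω ^ r)
  /-- `a i = a (i + q)` -/
  | periodicity (i : ℤ) : OkaRel p q r (OkaGen.fa i * (OkaGen.fa (i + (q : ℤ)))⁻¹)
  /-- `a (i + p) = ω * a i * ω⁻¹` -/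
  | conjugacy (i : ℤ) :
      OkaRel p q r
        (OkaGen.fa (i + (p : ℤ)) * (OkaGen.fω * OkaGen.fa i * OkaGen.fω⁻¹)⁻¹)

/-- Oka's group `G(p;q;r)` (used for positive `p`, `q`, `r`). -/
abbrev OkaGroup (p q r : ℕ) : Type := PresentedGroup {w : FreeGroup OkaGen | OkaRel p q r w}

/-- `(p, q, r)` is a normalized triple of positive integers:
`p ≥ q` and `q / gcd(p, q)` divides `r`. -/
def OkaNormalized (p q r : ℕ) : Prop :=
  0 < p ∧ 0 < q ∧ 0 < r ∧ q ≤ p ∧ q / Nat.gcd p q ∣ r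

/-!
Let `A n = a (n-1) * ⋯ * a 0` be the partial products of the generators, continued to all integers
`n`. In terms of `A` the relations of `G(p;q;r)` say that `A 0 = 1`, `A (n + p) = A p * A n`,
`A (n + q) = A n * A q` and `A p ^ r = 1` (`IsOkaSeq`, `OkaGroup.homEquiv`). Put `s = gcd (p, q)`,
`p = s p'`, `q = s q'`. The value of `A` at `lcm (p, q)` is the central element
`A p ^ q' = A q ^ p'`. If `a = gcd (q', r)`, then `A p ^ a` is central too, and this gives the
period `a s` (`OkaGroup.nonempty_mulEquiv_gcd`). The relations are exchanged by `A ↦ A⁻¹` together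
with `p ↔ q`, and this gives the second isomorphism (`OkaGroup.nonempty_mulEquiv_swap`).

For the uniqueness, let `r = m q'` and `s = t + 1`. Decomposing the integers into residue classes
modulo `s`, and using that `p`, `q` generate `s ℤ`, one sees that a homomorphism from `G(p;q;r)`
consists of the values `x = A p`, `y = A q` and `A 1, …, A t`, subject to `x ^ q' = y ^ p' = h`,
`h ^ m = 1` and the condition that `h` commutes with `A 1, …, A t`
(`card_hom_eq_card_amalgamHom`). The number of homomorphisms to a finite group is therefore a sum
over the values of `h` (`card_amalgamHom_eq_sum`), and the triple is recovered from such numbers.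

* Finite cyclic groups determine `t` and `p' q' m` (`rank_eq_and_torsion_eq`).
* Let `l` be a large prime with `l ≡ 1` modulo `K`, and consider the affine maps of `ℤ / l` whose
  linear part is a `K`-th root of unity. A homomorphism with `h ≠ 1` takes values in the stabilizer
  of the fixed point of `h`, which is cyclic of order `K`, so that these homomorphisms are counted
  by the commutative case; those with `h = 1` have a simple closed count
  (`CharAffine.card_amalgamHom`). Varying `K` one obtains `p' q'` and `p' + q'`, unless `t = 0` and
  `q' = 1`, in which case the group is finite cyclic (`mul_eq_and_add_eq_of_rank_pos`,
  `mul_eq_and_add_eq_of_rank_zero`).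
-/

/-! ### Sequences of partial products -/

section Sequences

variable {H : Type*} [Group H]

/-- The product `a (n-1) * ⋯ * a 0`. -/
def ascProd (a : ℤ → H) : ℕ → H
  | 0 => 1
  | n + 1 => a n * ascProd a n

/-- The product `(a (-n))⁻¹ * ⋯ * (a (-1))⁻¹`. -/
def negProd (a : ℤ → H) : ℕ → H
  | 0 => 1
  | n + 1 => (a (-(n + 1)))⁻¹ * negProd a n

/-- The sequence of partial products `A n = a (n-1) * ⋯ * a 0`, continued to negative `n` so that
`A (n + 1) = a n * A n` for every integer `n`. -/
def partialProd (a : ℤ → H) : ℤ → H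
  | .ofNat n => ascProd a n
  | .negSucc n => negProd a (n + 1)

@[simp] lemma partialProd_zero (a : ℤ → H) : partialProd a 0 = 1 := rfl

lemma partialProd_succ (a : ℤ → H) (n : ℤ) : partialProd a (n + 1) = a n * partialProd a n := by
  rcases n with n | n
  · rfl
  · rcases n with _ | n
    · simp [partialProd, negProd, ascProd]
    · have h : Int.negSucc (n + 1) + 1 = Int.negSucc n := by omega
      have h' : Int.negSucc (n + 1) = -((n + 1 : ℕ) + 1 : ℤ) := by omega
      rw [h]
      change negProd a (n + 1) = a (Int.negSucc (n + 1)) *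
        ((a (-((n + 1 : ℕ) + 1 : ℤ)))⁻¹ * negProd a (n + 1))
      rw [h', mul_inv_cancel_left]

/-- A sequence indexed by the integers is determined by its value at `0` and the quotients
`A (n + 1) * (A n)⁻¹`. -/
lemma eq_of_succ_eq_mul {a A B : ℤ → H} (hA : ∀ n, A (n + 1) = a n * A n)
    (hB : ∀ n, B (n + 1) = a n * B n) (h0 : A 0 = B 0) (n : ℤ) : A n = B n := by
  induction n using Int.induction_on with
  | zero => exact h0
  | succ n ih => rw [hA, hB, ih]
  | pred n ih =>
    have h1 := hA (-(n : ℤ) - 1)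
    have h2 := hB (-(n : ℤ) - 1)
    rw [sub_add_cancel] at h1 h2
    rw [h1, h2] at ih
    exact mul_left_cancel ih

lemma prod_range_reverse_map_eq_partialProd (a : ℤ → H) (n : ℕ) :
    ((List.range n).reverse.map fun j : ℕ => a j).prod = partialProd a n := by
  induction n with
  | zero => rfl
  | succ n ih =>
    rw [List.range_succ, List.reverse_append, List.reverse_singleton, List.singleton_append,
      List.map_cons, List.prod_cons, ih, Nat.cast_succ, partialProd_succ]

/-- Sequences `A : ℤ → H` with the properties of the partial products `A n = a (n-1) * ⋯ * a 0` of
the generators of Oka's group: a translation by `p` multiplies `A` by `ω = A p` on the left, and a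
translation by `q` multiplies it by `A q` on the right. -/
structure IsOkaSeq (p q r : ℕ) (A : ℤ → H) : Prop where
  map_zero : A 0 = 1
  add_left : ∀ n : ℤ, A (n + p) = A p * A n
  add_right : ∀ n : ℤ, A (n + q) = A n * A q
  pow_eq_one : A p ^ r = 1

namespace IsOkaSeq

variable {p q r : ℕ} {A : ℤ → H}

lemma add_mul_left (hA : IsOkaSeq p q r A) (n k : ℤ) : A (n + k * p) = A p ^ k * A n := by
  induction k using Int.induction_on with
  | zero => simp
  | succ k ih =>
    rw [add_mul, one_mul, ← add_assoc, hA.add_left, ih, add_comm (k : ℤ), zpow_one_add, mul_assoc]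
  | pred k ih =>
    have h := hA.add_left (n + (-(k : ℤ) - 1) * p)
    rw [show n + (-(k : ℤ) - 1) * p + p = n + -(k : ℤ) * p by ring, ih] at h
    rw [eq_inv_mul_of_mul_eq h.symm, zpow_sub_one, ← mul_assoc]
    congr 1
    exact ((Commute.refl (A p)).inv_left.zpow_right _)

lemma add_mul_right (hA : IsOkaSeq p q r A) (n k : ℤ) : A (n + k * q) = A n * A q ^ k := by
  induction k using Int.induction_on with
  | zero => simp
  | succ k ih =>
    rw [add_mul, one_mul, ← add_assoc, hA.add_right, ih, zpow_add_one, mul_assoc]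
  | pred k ih =>
    have h := hA.add_right (n + (-(k : ℤ) - 1) * q)
    rw [show n + (-(k : ℤ) - 1) * q + q = n + -(k : ℤ) * q by ring, ih] at h
    rw [eq_mul_inv_of_mul_eq h.symm, zpow_sub_one, mul_assoc]

/-- Both sides are the value of the sequence at `p * q / s = lcm (p, q)`, for `s = gcd (p, q)`. -/
lemma pow_eq_pow (hA : IsOkaSeq p q r A) {s p' q' : ℕ} (hp : p = s * p') (hq : q = s * q') :
    A p ^ q' = A q ^ p' := by
  have h1 := hA.add_mul_left 0 q'
  have h2 := hA.add_mul_right 0 p'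
  rw [show (0 : ℤ) + q' * p = 0 + p' * q by subst hp hq; push_cast; ring, h2, hA.map_zero,
    mul_one, one_mul, zpow_natCast, zpow_natCast] at h1
  exact h1.symm

/-- The translation by `p * q / s` acts both on the left and on the right. -/
lemma commute_pow (hA : IsOkaSeq p q r A) {s p' q' : ℕ} (hp : p = s * p') (hq : q = s * q')
    (n : ℤ) : Commute (A n) (A p ^ q') := by
  have h1 := hA.add_mul_left n q'
  have h2 := hA.add_mul_right n p'
  rw [show (n : ℤ) + q' * p = n + p' * q by subst hp hq; push_cast; ring, h2, zpow_natCast,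
    zpow_natCast, ← hA.pow_eq_pow hp hq] at h1
  exact h1

/-- Inverting the sequence exchanges the roles of `p` and `q`. -/
lemma inv (hA : IsOkaSeq p q r A) {r' : ℕ} (h : A q ^ r' = 1) :
    IsOkaSeq q p r' fun n => (A n)⁻¹ where
  map_zero := by simp [hA.map_zero]
  add_left n := by rw [hA.add_right, mul_inv_rev]
  add_right n := by rw [hA.add_left, mul_inv_rev]
  pow_eq_one := by rw [inv_pow, h, inv_one]

lemma map {K : Type*} [Group K] (hA : IsOkaSeq p q r A) (φ : H →* K) :
    IsOkaSeq p q r fun n => φ (A n) where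
  map_zero := by simp [hA.map_zero]
  add_left n := by rw [hA.add_left, map_mul]
  add_right n := by rw [hA.add_right, map_mul]
  pow_eq_one := by rw [← map_pow, hA.pow_eq_one, map_one]

/-- `A p ^ a` with `a = gcd (q / s, r)` commutes with every value, so the translation by `p * a`
is a translation on the right; combined with the translation by `q` this gives the one by
`a * s = gcd (p * a, q)`. -/
lemma gcd_right (hA : IsOkaSeq p q r A) {s p' q' a : ℕ} (hp : p = s * p') (hq : q = s * q')
    (hpq : Nat.Coprime p' q') (ha : a = Nat.gcd q' r) : IsOkaSeq p (a * s) r A where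
  map_zero := hA.map_zero
  add_left := hA.add_left
  add_right := by
    have hcomm' (n : ℤ) : A p ^ a * A n = A n * A p ^ a := by
      have hz : A p ^ a = (A p ^ q') ^ Nat.gcdA q' r := by
        rw [← zpow_natCast, ha, Nat.gcd_eq_gcd_ab, zpow_add, zpow_mul, zpow_mul, zpow_natCast,
          zpow_natCast, hA.pow_eq_one, one_zpow, mul_one]
      rw [hz]
      exact (hA.commute_pow hp hq n).symm.zpow_left _
    obtain ⟨u, v, huv⟩ : ∃ u v : ℤ, (a * s : ℤ) = u * a * p + v * q := by
      obtain ⟨b, hb⟩ : a ∣ q' := ha ▸ Nat.gcd_dvd_left q' r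
      have hc : Nat.Coprime p' b := Nat.Coprime.coprime_dvd_right ⟨a, by rw [hb, mul_comm]⟩ hpq
      have h1 := Nat.gcd_eq_gcd_ab p' b
      rw [hc.gcd_eq_one] at h1
      push_cast at h1
      refine ⟨Nat.gcdA p' b, Nat.gcdB p' b, ?_⟩
      subst hp hq hb
      push_cast
      linear_combination (a * s : ℤ) * h1
    have key (n : ℤ) : A (n + (a * s : ℕ)) = A n * ((A p ^ a) ^ u * A q ^ v) := by
      push_cast
      rw [huv, ← add_assoc, hA.add_mul_right, hA.add_mul_left, mul_comm u, zpow_mul, zpow_natCast,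
        ((show Commute (A p ^ a) (A n) from hcomm' n).zpow_left u).eq, mul_assoc]
    intro n
    have h0 := key 0
    rw [zero_add, hA.map_zero, one_mul] at h0
    rw [key n, ← h0]
  pow_eq_one := hA.pow_eq_one

lemma mul_right (hA : IsOkaSeq p q r A) (k : ℕ) : IsOkaSeq p (k * q) r A where
  map_zero := hA.map_zero
  add_left := hA.add_left
  add_right n := by
    have h1 := hA.add_mul_right n k
    have h0 := hA.add_mul_right 0 k
    rw [zero_add, hA.map_zero, one_mul] at h0
    push_cast
    rw [h1, ← h0]
  pow_eq_one := hA.pow_eq_one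

end IsOkaSeq

end Sequences

/-! ### The universal property of Oka's group and its isomorphisms -/

namespace OkaGroup

open OkaGen

variable {p q r : ℕ} {H : Type*} [Group H]

/-- The image of the generator `a i` in Oka's group. -/
def gen (p q r : ℕ) (i : ℤ) : OkaGroup p q r := PresentedGroup.of (OkaGen.a i)

/-- The image of the generator `ω` in Oka's group. -/
def omega (p q r : ℕ) : OkaGroup p q r := PresentedGroup.of OkaGen.ω

/-- The partial products of the generators `a i` of Oka's group. -/
def seq (p q r : ℕ) : ℤ → OkaGroup p q r := partialProd (gen p q r)

lemma map_descProd (φ : FreeGroup OkaGen →* H) (p : ℕ) :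
    φ (descProd p) = partialProd (fun i => φ (fa i)) p := by
  rw [descProd, map_list_prod, List.map_map,
    ← prod_range_reverse_map_eq_partialProd (fun i => φ (fa i))]
  rfl

lemma mk_eq_one {w : FreeGroup OkaGen} (hw : OkaRel p q r w) :
    PresentedGroup.mk {w | OkaRel p q r w} w = 1 :=
  PresentedGroup.one_of_mem hw

lemma omega_eq (p q r : ℕ) : omega p q r = seq p q r p := by
  have h := mk_eq_one (OkaRel.omega_eq (p := p) (q := q) (r := r))
  rw [map_mul, map_inv, mul_inv_eq_one, map_descProd] at h
  exact h

lemma gen_add_right (i : ℤ) : gen p q r (i + q) = gen p q r i := by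
  have h := mk_eq_one (OkaRel.periodicity (p := p) (q := q) (r := r) i)
  rw [map_mul, map_inv, mul_inv_eq_one] at h
  exact h.symm

lemma gen_add_left (i : ℤ) :
    gen p q r (i + p) = omega p q r * gen p q r i * (omega p q r)⁻¹ := by
  have h := mk_eq_one (OkaRel.conjugacy (p := p) (q := q) (r := r) i)
  rw [map_mul, map_inv, mul_inv_eq_one, map_mul, map_mul, map_inv] at h
  exact h

lemma omega_pow : omega p q r ^ r = 1 := by
  have h := mk_eq_one (OkaRel.omega_pow (p := p) (q := q) (r := r))
  rwa [map_pow] at h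

lemma isOkaSeq_seq (p q r : ℕ) : IsOkaSeq p q r (seq p q r) where
  map_zero := rfl
  add_left := by
    rw [← omega_eq]
    refine eq_of_succ_eq_mul (a := fun n => gen p q r (n + p)) (fun n => ?_) (fun n => ?_) ?_
    · rw [add_right_comm]
      exact partialProd_succ _ _
    · rw [seq, partialProd_succ, gen_add_left]
      group
    · rw [zero_add, ← omega_eq, seq, partialProd_zero, mul_one]
  add_right := by
    refine eq_of_succ_eq_mul (a := gen p q r) (fun n => ?_) (fun n => ?_) ?_
    · rw [add_right_comm, seq, partialProd_succ, gen_add_right]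
    · rw [seq, partialProd_succ, mul_assoc]
    · rw [zero_add, seq, partialProd_zero, one_mul]
  pow_eq_one := by rw [← omega_eq, omega_pow]

lemma gen_eq (i : ℤ) : gen p q r i = seq p q r (i + 1) * (seq p q r i)⁻¹ :=
  eq_mul_inv_of_mul_eq (partialProd_succ _ _).symm

/-- The values on the generating symbols of the homomorphism with partial products `A`. -/
def liftFun (p : ℕ) (A : ℤ → H) : OkaGen → H
  | OkaGen.ω => A p
  | OkaGen.a i => A (i + 1) * (A i)⁻¹

lemma partialProd_quotient {A : ℤ → H} (h0 : A 0 = 1) (n : ℤ) :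
    partialProd (fun i => A (i + 1) * (A i)⁻¹) n = A n :=
  eq_of_succ_eq_mul (partialProd_succ _) (fun n => (inv_mul_cancel_right _ _).symm)
    (by rw [partialProd_zero, h0]) n

lemma lift_rel {A : ℤ → H} (hA : IsOkaSeq p q r A) :
    ∀ w ∈ {w : FreeGroup OkaGen | OkaRel p q r w}, FreeGroup.lift (liftFun p A) w = 1 := by
  have hω : FreeGroup.lift (liftFun p A) fω = A p := FreeGroup.lift_apply_of
  have ha (i : ℤ) : FreeGroup.lift (liftFun p A) (fa i) = A (i + 1) * (A i)⁻¹ :=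
    FreeGroup.lift_apply_of
  rintro w (_ | _ | i | i)
  · rw [map_mul, map_inv, map_descProd, hω]
    simp only [ha]
    rw [partialProd_quotient hA.map_zero, mul_inv_cancel]
  · rw [map_pow, hω, hA.pow_eq_one]
  · rw [map_mul, map_inv, ha, ha, add_right_comm, hA.add_right, hA.add_right]
    group
  · simp only [map_mul, map_inv, ha, hω]
    rw [add_right_comm, hA.add_left, hA.add_left]
    group

/-- The homomorphism from Oka's group with prescribed partial products of the generators. -/
def lift {A : ℤ → H} (hA : IsOkaSeq p q r A) : OkaGroup p q r →* H :=
  PresentedGroup.toGroup (lift_rel hA)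

@[simp] lemma lift_seq {A : ℤ → H} (hA : IsOkaSeq p q r A) (n : ℤ) :
    lift hA (seq p q r n) = A n := by
  refine eq_of_succ_eq_mul (a := fun i => A (i + 1) * (A i)⁻¹)
    (A := fun n => lift hA (seq p q r n)) (fun n => ?_)
    (fun n => (inv_mul_cancel_right _ _).symm) ?_ n
  · rw [seq, partialProd_succ, map_mul]
    congr 1
    exact PresentedGroup.toGroup.of (lift_rel hA)
  · rw [seq, partialProd_zero, map_one, hA.map_zero]

lemma hom_ext {φ ψ : OkaGroup p q r →* H} (h : ∀ n, φ (seq p q r n) = ψ (seq p q r n)) :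
    φ = ψ := by
  refine PresentedGroup.ext fun x => ?_
  rcases x with _ | i
  · change φ (omega p q r) = ψ (omega p q r)
    rw [omega_eq, h]
  · change φ (gen p q r i) = ψ (gen p q r i)
    rw [gen_eq, map_mul, map_mul, map_inv, map_inv, h, h]

/-- Homomorphisms from Oka's group correspond to sequences of partial products. -/
def homEquiv (p q r : ℕ) (H : Type*) [Group H] :
    (OkaGroup p q r →* H) ≃ {A : ℤ → H // IsOkaSeq p q r A} where
  toFun φ := ⟨fun n => φ (seq p q r n), (isOkaSeq_seq p q r).map φ⟩
  invFun A := lift A.2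
  left_inv _ := hom_ext fun n => lift_seq _ n
  right_inv A := Subtype.ext <| funext fun n => lift_seq A.2 n

/-- Both groups have the same sequences of partial products. -/
theorem nonempty_mulEquiv_gcd {s p' q' a : ℕ} (hp : p = s * p') (hq : q = s * q')
    (hpq : Nat.Coprime p' q') (ha : a = Nat.gcd q' r) :
    Nonempty (OkaGroup p q r ≃* OkaGroup p (a * s) r) := by
  obtain ⟨b, hb⟩ : a ∣ q' := ha ▸ Nat.gcd_dvd_left q' r
  have hq' : b * (a * s) = q := by rw [hq, hb]; ring
  have h1 : IsOkaSeq p q r (seq p (a * s) r) := by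
    have := (isOkaSeq_seq p (a * s) r).mul_right b
    rwa [hq'] at this
  have h2 := (isOkaSeq_seq p q r).gcd_right hp hq hpq ha
  exact ⟨MonoidHom.toMulEquiv (lift h1) (lift h2) (hom_ext fun n => by simp)
    (hom_ext fun n => by simp)⟩

/-- The isomorphism inverts the partial products of the generators. -/
theorem nonempty_mulEquiv_swap {s p' q' m : ℕ} (hp : p = s * p') (hq : q = s * q')
    (hr : r = m * q') : Nonempty (OkaGroup p q r ≃* OkaGroup q p (m * p')) := by
  have h1 : IsOkaSeq p q r fun n => (seq q p (m * p') n)⁻¹ := by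
    refine (isOkaSeq_seq q p (m * p')).inv ?_
    rw [hr, mul_comm m q', pow_mul, ← (isOkaSeq_seq q p (m * p')).pow_eq_pow hq hp, ← pow_mul,
      mul_comm p' m, (isOkaSeq_seq q p (m * p')).pow_eq_one]
  have h2 : IsOkaSeq q p (m * p') fun n => (seq p q r n)⁻¹ := by
    refine (isOkaSeq_seq p q r).inv ?_
    rw [mul_comm m p', pow_mul, ← (isOkaSeq_seq p q r).pow_eq_pow hp hq, ← pow_mul, mul_comm q' m,
      ← hr, (isOkaSeq_seq p q r).pow_eq_one]
  exact ⟨MonoidHom.toMulEquiv (lift h1) (lift h2) (hom_ext fun n => by simp)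
    (hom_ext fun n => by simp)⟩

lemma eq_top_of_gen_mem {S : Subgroup (OkaGroup p q r)} (h : ∀ i, gen p q r i ∈ S) : S = ⊤ := by
  have hseq (n : ℤ) : seq p q r n ∈ S := by
    induction n using Int.induction_on with
    | zero => exact S.one_mem
    | succ n ih =>
      rw [seq, partialProd_succ]
      exact S.mul_mem (h _) ih
    | pred n ih =>
      have h1 := partialProd_succ (gen p q r) (-(n : ℤ) - 1)
      rw [sub_add_cancel] at h1
      rw [seq, eq_inv_mul_of_mul_eq h1.symm]
      exact S.mul_mem (S.inv_mem (h _)) ih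
  rw [eq_top_iff, ← PresentedGroup.closure_range_of, Subgroup.closure_le]
  rintro _ ⟨(_ | i), rfl⟩
  · change omega p q r ∈ S
    rw [omega_eq]
    exact hseq p
  · exact h i

/-- For `q = 1` all generators `a i` coincide, and their common value has finite order. -/
theorem finite_and_isCyclic_of_one (hp : 0 < p) (hr : 0 < r) :
    Finite (OkaGroup p 1 r) ∧ IsCyclic (OkaGroup p 1 r) := by
  have hA := isOkaSeq_seq p 1 r
  have hg (i : ℤ) : gen p 1 r i = gen p 1 r 0 := by
    induction i using Int.induction_on with
    | zero => rfl
    | succ n ih => rw [← ih]; exact gen_add_right (p := p) (q := 1) (r := r) _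
    | pred n ih =>
      rw [← ih]
      have := gen_add_right (p := p) (q := 1) (r := r) (-(n : ℤ) - 1)
      rw [Nat.cast_one, sub_add_cancel] at this
      exact this.symm
  have htop : Subgroup.zpowers (gen p 1 r 0) = ⊤ :=
    eq_top_of_gen_mem fun i => by rw [hg i]; exact Subgroup.mem_zpowers (gen p 1 r 0)
  have hpow : gen p 1 r 0 ^ (p * r) = 1 := by
    have h1 := hA.pow_eq_pow (s := 1) (p' := p) (q' := 1) (by simp) (by simp)
    have h2 : seq p 1 r (1 : ℕ) = gen p 1 r 0 := by
      have := partialProd_succ (gen p 1 r) 0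
      rwa [partialProd_zero, mul_one] at this
    rw [pow_one, h2] at h1
    rw [pow_mul, ← h1, hA.pow_eq_one]
  have hfin : IsOfFinOrder (gen p 1 r 0) :=
    isOfFinOrder_iff_pow_eq_one.2 ⟨p * r, Nat.mul_pos hp hr, hpow⟩
  refine ⟨?_, isCyclic_iff_exists_zpowers_eq_top.2 ⟨_, htop⟩⟩
  have := hfin.finite_zpowers
  rw [htop] at this
  exact Set.finite_univ_iff.1 this

end OkaGroup

/-! ### Homomorphisms as homomorphisms from an amalgam -/

/-- Homomorphisms to `H`, encoded by the images of the generators, from the amalgam of `⟨x⟩`, `⟨y⟩`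
and `⟨h⟩ × F_t` (with `F_t` free of rank `t`) along `x ^ q' = y ^ p' = h`, where `h ^ m = 1`. -/
abbrev AmalgamHom (t p' q' m : ℕ) (H : Type*) [Group H] : Type _ :=
  {d : H × H × (Fin t → H) //
    d.1 ^ q' = d.2.1 ^ p' ∧ (d.1 ^ q') ^ m = 1 ∧ ∀ j, Commute (d.2.2 j) (d.1 ^ q')}

section Glue

variable {H : Type*} [Group H] {t : ℕ}

lemma toNat_emod_lt (t : ℕ) (n : ℤ) : (n % (t + 1 : ℕ)).toNat < t + 1 := by
  have := Int.emod_lt_of_pos n (b := (t + 1 : ℕ)) (by positivity)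
  omega

/-- The extension of `f` by the value `1` at `0`, read modulo `t + 1`. -/
def residueValue (f : Fin t → H) (n : ℤ) : H :=
  (Fin.cons 1 f : Fin (t + 1) → H) ⟨(n % (t + 1 : ℕ)).toNat, toNat_emod_lt t n⟩

lemma residueValue_zero (f : Fin t → H) : residueValue f 0 = 1 := by
  have : (⟨((0 : ℤ) % (t + 1 : ℕ)).toNat, toNat_emod_lt t 0⟩ : Fin (t + 1)) = 0 := by
    ext; simp
  rw [residueValue, this, Fin.cons_zero]

lemma residueValue_succ (f : Fin t → H) (j : Fin t) : residueValue f ((j : ℤ) + 1) = f j := by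
  have : (⟨(((j : ℤ) + 1) % (t + 1 : ℕ)).toNat, toNat_emod_lt t _⟩ : Fin (t + 1)) = j.succ := by
    ext
    have := j.2
    change (((j : ℤ) + 1) % (t + 1 : ℕ)).toNat = _
    rw [Int.emod_eq_of_lt (by omega) (by omega)]
    simp
  rw [residueValue, this, Fin.cons_succ]

lemma residueValue_add_mul (f : Fin t → H) (n k : ℤ) :
    residueValue f (n + (t + 1 : ℕ) * k) = residueValue f n := by
  simp only [residueValue, Int.add_mul_emod_self_left]

/-- The sequence with `A (j + k * p + l * q) = x ^ k * A j * y ^ l`, where `A j` for `0 ≤ j ≤ t` is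
prescribed by `f`. The coefficients `u`, `v` with `p' * u + q' * v = 1` serve to write
`(t + 1) * k = k * u * p + k * v * q`. -/
def glueSeq (u v : ℤ) (x y : H) (f : Fin t → H) (n : ℤ) : H :=
  x ^ (n / (t + 1 : ℕ) * u) * residueValue f n * y ^ (n / (t + 1 : ℕ) * v)

lemma glueSeq_of_lt {u v : ℤ} {x y : H} (f : Fin t → H) {n : ℤ} (h0 : 0 ≤ n)
    (hn : n < (t + 1 : ℕ)) : glueSeq u v x y f n = residueValue f n := by
  rw [glueSeq, Int.ediv_eq_zero_of_lt h0 hn]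
  simp

lemma commute_residueValue {f : Fin t → H} {h : H} (hf : ∀ j, Commute (f j) h) (n : ℤ) :
    Commute (residueValue f n) h := by
  unfold residueValue
  generalize (⟨_, _⟩ : Fin (t + 1)) = i
  refine Fin.cases ?_ (fun j => ?_) i
  · rw [Fin.cons_zero]; exact Commute.one_left _
  · rw [Fin.cons_succ]; exact hf j

variable {p' q' : ℕ} {u v : ℤ} {x y : H} {f : Fin t → H}

lemma glueSeq_add_left (huv : p' * u + q' * v = 1) (hxy : x ^ q' = y ^ p')
    (hf : ∀ j, Commute (f j) (x ^ q')) (n : ℤ) :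
    glueSeq u v x y f (n + ((t + 1) * p' : ℕ)) = x * glueSeq u v x y f n := by
  have hd : (n + ((t + 1) * p' : ℕ)) / ((t + 1 : ℕ) : ℤ) = n / (t + 1 : ℕ) + p' := by
    rw [Nat.cast_mul, Int.add_mul_ediv_left _ _ (by positivity)]
  have hx : x ^ (p' * u) = x * (x ^ q') ^ (-v) := by
    rw [show (p' * u : ℤ) = 1 + q' * (-v) by linear_combination huv, zpow_one_add, zpow_mul,
      zpow_natCast]
  have hy : y ^ (p' * v) = (x ^ q') ^ v := by rw [zpow_mul, zpow_natCast, hxy]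
  have hcx : Commute ((x ^ q') ^ (-v)) (x ^ (n / (t + 1 : ℕ) * u)) :=
    (((Commute.refl x).pow_left q').zpow_left (-v)).zpow_right _
  have hcf : Commute ((x ^ q') ^ (-v)) (residueValue f n) :=
    ((commute_residueValue hf n).symm).zpow_left _
  unfold glueSeq
  rw [hd, add_mul _ _ u, add_mul _ _ v, add_comm (_ * u), zpow_add, add_comm (_ * v), zpow_add, hx, hy,
    Nat.cast_mul, residueValue_add_mul]
  calc x * (x ^ q') ^ (-v) * x ^ (n / (t + 1 : ℕ) * u) * residueValue f n *
        ((x ^ q') ^ v * y ^ (n / (t + 1 : ℕ) * v))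
      = x * ((x ^ q') ^ (-v) * (x ^ (n / (t + 1 : ℕ) * u)) * residueValue f n) *
        ((x ^ q') ^ v * y ^ (n / (t + 1 : ℕ) * v)) := by simp only [mul_assoc]
    _ = _ := by rw [mul_assoc ((x ^ q') ^ (-v)), (hcx.mul_right hcf).eq, zpow_neg]; group

lemma glueSeq_add_right (huv : p' * u + q' * v = 1) (hxy : x ^ q' = y ^ p')
    (hf : ∀ j, Commute (f j) (x ^ q')) (n : ℤ) :
    glueSeq u v x y f (n + ((t + 1) * q' : ℕ)) = glueSeq u v x y f n * y := by
  have hd : (n + ((t + 1) * q' : ℕ)) / ((t + 1 : ℕ) : ℤ) = n / (t + 1 : ℕ) + q' := by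
    rw [Nat.cast_mul, Int.add_mul_ediv_left _ _ (by positivity)]
  have hx : x ^ (q' * u) = (x ^ q') ^ u := by rw [zpow_mul, zpow_natCast]
  have hy : y ^ (q' * v) = (x ^ q') ^ (-u) * y := by
    rw [show (q' * v : ℤ) = p' * (-u) + 1 by linear_combination huv, zpow_add_one, zpow_mul,
      zpow_natCast, hxy]
  have hcf : Commute ((x ^ q') ^ u) (residueValue f n) :=
    ((commute_residueValue hf n).symm).zpow_left _
  have hcy : Commute ((x ^ q') ^ u) (y ^ (n / (t + 1 : ℕ) * v)) := by
    rw [hxy]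
    exact (((Commute.refl y).pow_left p').zpow_left u).zpow_right _
  unfold glueSeq
  rw [hd, add_mul _ _ u, add_mul _ _ v, zpow_add, zpow_add, hx, hy, Nat.cast_mul,
    residueValue_add_mul]
  calc x ^ (n / (t + 1 : ℕ) * u) * (x ^ q') ^ u * residueValue f n *
        (y ^ (n / (t + 1 : ℕ) * v) * ((x ^ q') ^ (-u) * y))
      = x ^ (n / (t + 1 : ℕ) * u) *
        ((x ^ q') ^ u * (residueValue f n * y ^ (n / (t + 1 : ℕ) * v))) *
        ((x ^ q') ^ (-u) * y) := by simp only [mul_assoc]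
    _ = _ := by rw [(hcf.mul_right hcy).eq, zpow_neg]; group

lemma glueSeq_zero : glueSeq u v x y f 0 = 1 := by
  rw [glueSeq_of_lt f le_rfl (by positivity), residueValue_zero]

lemma isOkaSeq_glueSeq {m : ℕ} (huv : p' * u + q' * v = 1) (hxy : x ^ q' = y ^ p')
    (hm : (x ^ q') ^ m = 1) (hf : ∀ j, Commute (f j) (x ^ q')) :
    IsOkaSeq ((t + 1) * p') ((t + 1) * q') (m * q') (glueSeq u v x y f) ∧
      glueSeq u v x y f ((t + 1) * p' : ℕ) = x ∧ glueSeq u v x y f ((t + 1) * q' : ℕ) = y := by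
  have hx : glueSeq u v x y f ((t + 1) * p' : ℕ) = x := by
    have := glueSeq_add_left huv hxy hf 0
    rwa [zero_add, glueSeq_zero, mul_one] at this
  have hy : glueSeq u v x y f ((t + 1) * q' : ℕ) = y := by
    have := glueSeq_add_right huv hxy hf 0
    rwa [zero_add, glueSeq_zero, one_mul] at this
  refine ⟨⟨glueSeq_zero, fun n => ?_, fun n => ?_, ?_⟩, hx, hy⟩
  · rw [hx, glueSeq_add_left huv hxy hf]
  · rw [hy, glueSeq_add_right huv hxy hf]
  · rw [hx, mul_comm m, pow_mul, hm]

lemma IsOkaSeq.glueSeq_eq {r : ℕ} {A : ℤ → H} (hA : IsOkaSeq ((t + 1) * p') ((t + 1) * q') r A)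
    (huv : p' * u + q' * v = 1) (n : ℤ) :
    glueSeq u v (A ((t + 1) * p' : ℕ)) (A ((t + 1) * q' : ℕ)) (fun j : Fin t => A ((j : ℤ) + 1)) n
      = A n := by
  set k := n / ((t + 1 : ℕ) : ℤ) with hk
  have hn : n = n % ((t + 1 : ℕ) : ℤ) + (k * u) * ((t + 1) * p' : ℕ) +
      (k * v) * ((t + 1) * q' : ℕ) := by
    have := Int.emod_add_mul_ediv n ((t + 1 : ℕ) : ℤ)
    rw [← hk] at this
    push_cast at this ⊢
    linear_combination -this - (t + 1 : ℤ) * k * huv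
  have hres : residueValue (fun j : Fin t => A ((j : ℤ) + 1)) n = A (n % ((t + 1 : ℕ) : ℤ)) := by
    unfold residueValue
    have hcast : A (n % ((t + 1 : ℕ) : ℤ)) = A ((n % ((t + 1 : ℕ) : ℤ)).toNat : ℤ) := by
      rw [Int.toNat_of_nonneg (Int.emod_nonneg _ (by positivity))]
    have (i : Fin (t + 1)) :
        (Fin.cons 1 (fun j : Fin t => A ((j : ℤ) + 1)) : Fin (t + 1) → H) i = A ((i : ℕ) : ℤ) := by
      refine Fin.cases ?_ (fun j => ?_) i
      · rw [Fin.cons_zero]; exact hA.map_zero.symm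
      · rw [Fin.cons_succ, Fin.val_succ, Nat.cast_succ]
    rw [hcast, this]
  conv_rhs => rw [hn, hA.add_mul_right, hA.add_mul_left]
  rw [glueSeq, hres]

end Glue

/-- Homomorphisms from `G(p;q;r)`, `r` a multiple of `q / gcd(p, q)`, are given by the values of
`ω`, of `A q = a (q-1) * ⋯ * a 0` and of the first `gcd(p, q) - 1` partial products. -/
theorem card_hom_eq_card_amalgamHom {t p' q' m : ℕ} (hpq : Nat.Coprime p' q') (H : Type*)
    [Group H] :
    Nat.card (OkaGroup ((t + 1) * p') ((t + 1) * q') (m * q') →* H) =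
      Nat.card (AmalgamHom t p' q' m H) := by
  have huv : (p' * Nat.gcdA p' q' + q' * Nat.gcdB p' q' : ℤ) = 1 := by
    rw [← Nat.gcd_eq_gcd_ab, hpq.gcd_eq_one, Nat.cast_one]
  refine Nat.card_congr ((OkaGroup.homEquiv _ _ _ H).trans ?_)
  refine
    { toFun := fun A => ⟨(A.1 ((t + 1) * p' : ℕ), A.1 ((t + 1) * q' : ℕ),
        fun j => A.1 ((j : ℤ) + 1)), A.2.pow_eq_pow rfl rfl, ?_, fun j => ?_⟩
      invFun := fun d => ⟨_, (isOkaSeq_glueSeq huv d.2.1 d.2.2.1 d.2.2.2).1⟩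
      left_inv := fun A => Subtype.ext <| funext fun n => A.2.glueSeq_eq huv n
      right_inv := fun d => Subtype.ext ?_ }
  · exact (pow_mul' _ m q').symm.trans A.2.pow_eq_one
  · exact A.2.commute_pow rfl rfl _
  · obtain ⟨-, hx, hy⟩ := isOkaSeq_glueSeq huv d.2.1 d.2.2.1 d.2.2.2
    refine Prod.ext hx (Prod.ext hy (funext fun j => ?_))
    have := j.2
    exact (glueSeq_of_lt _ (by omega) (by omega)).trans (residueValue_succ _ j)

/-! ### Counting homomorphisms to a finite group -/

section Counting

variable {H : Type*} [Group H]

/-- The number of `k`-th roots of `h`. -/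
noncomputable def numRoots (k : ℕ) (h : H) : ℕ := Nat.card {x : H // x ^ k = h}

/-- The order of the centralizer of `h`. -/
noncomputable def centralizerCard (h : H) : ℕ := Nat.card {g : H // Commute g h}

/-- The number of homomorphisms sending the central element to `h`, if `h ^ m = 1`. -/
noncomputable def fibreCard (t p' q' : ℕ) (h : H) : ℕ :=
  numRoots q' h * numRoots p' h * centralizerCard h ^ t

open Classical in
lemma card_amalgamHom_eq_sum [Fintype H] (t p' q' m : ℕ) :
    Nat.card (AmalgamHom t p' q' m H) =
      ∑ h : H, if h ^ m = 1 then fibreCard t p' q' h else 0 := by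
  have : Finite (AmalgamHom t p' q' m H) := Subtype.finite
  rw [← Nat.card_congr (Equiv.sigmaFiberEquiv fun d : AmalgamHom t p' q' m H => d.1.1 ^ q'),
    Nat.card_sigma]
  refine Finset.sum_congr rfl fun h _ => ?_
  split_ifs with hm
  · have e : {d : AmalgamHom t p' q' m H // d.1.1 ^ q' = h} ≃
        ({x : H // x ^ q' = h} × {y : H // y ^ p' = h}) × (Fin t → {g : H // Commute g h}) :=
      { toFun := fun d => ((⟨d.1.1.1, d.2⟩, ⟨d.1.1.2.1, d.1.2.1.symm.trans d.2⟩),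
          fun j => ⟨d.1.1.2.2 j, by have := d.1.2.2.2 j; rwa [d.2] at this⟩)
        invFun := fun e => ⟨⟨(e.1.1.1, e.1.2.1, fun j => (e.2 j).1),
          e.1.1.2.trans e.1.2.2.symm, by rw [e.1.1.2, hm],
          fun j => by rw [e.1.1.2]; exact (e.2 j).2⟩, e.1.1.2⟩
        left_inv := fun d => rfl
        right_inv := fun e => rfl }
    rw [Nat.card_congr e, Nat.card_prod, Nat.card_prod, Nat.card_fun, Nat.card_fin]
    rfl
  · rw [Nat.card_eq_zero]
    refine Or.inl ⟨fun d => hm ?_⟩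
    rw [← d.2]
    exact d.1.2.2.1

lemma numRoots_one_pos [Finite H] (k : ℕ) : 0 < numRoots k (1 : H) := by
  have : Nonempty {x : H // x ^ k = 1} := ⟨⟨1, one_pow k⟩⟩
  exact Nat.card_pos

lemma centralizerCard_one : centralizerCard (1 : H) = Nat.card H :=
  Nat.card_congr (Equiv.subtypeUnivEquiv fun g => Commute.one_right g)

end Counting

section Commutative

variable {U : Type*} [CommGroup U]

/-- The free generators are unconstrained, and two elements `x`, `y` of a commutative group with
`x ^ q' = y ^ p'` are the powers `z ^ p'` and `z ^ q'` of a unique `z`. -/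
theorem card_amalgamHom_of_comm {t p' q' m : ℕ} (hpq : Nat.Coprime p' q') :
    Nat.card (AmalgamHom t p' q' m U) = numRoots (p' * q' * m) (1 : U) * Nat.card U ^ t := by
  have huv : (p' * Nat.gcdA p' q' + q' * Nat.gcdB p' q' : ℤ) = 1 := by
    rw [← Nat.gcd_eq_gcd_ab, hpq.gcd_eq_one, Nat.cast_one]
  set u := Nat.gcdA p' q'
  set v := Nat.gcdB p' q'
  have hx {x y : U} (hxy : x ^ q' = y ^ p') : (x ^ u * y ^ v) ^ p' = x := by
    rw [mul_pow, ← zpow_natCast (y ^ v), zpow_comm, zpow_natCast, ← hxy, ← zpow_natCast,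
      ← zpow_natCast, ← zpow_mul, ← zpow_mul, ← zpow_add, mul_comm u, huv, zpow_one]
  have hy {x y : U} (hxy : x ^ q' = y ^ p') : (x ^ u * y ^ v) ^ q' = y := by
    rw [mul_pow, ← zpow_natCast (x ^ u), zpow_comm, zpow_natCast, hxy, ← zpow_natCast,
      ← zpow_natCast, ← zpow_mul, ← zpow_mul, ← zpow_add, mul_comm v, huv, zpow_one]
  have e : AmalgamHom t p' q' m U ≃ {z : U // z ^ (p' * q' * m) = 1} × (Fin t → U) :=
    { toFun := fun d => (⟨d.1.1 ^ u * d.1.2.1 ^ v, by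
          rw [pow_mul, pow_mul, hx d.2.1, d.2.2.1]⟩, d.1.2.2)
      invFun := fun e => ⟨(e.1.1 ^ p', e.1.1 ^ q', e.2), by rw [← pow_mul, pow_mul'],
        by rw [← pow_mul, ← pow_mul, ← mul_assoc, e.1.2], fun j => Commute.all _ _⟩
      left_inv := fun d => Subtype.ext (Prod.ext (hx d.2.1) (Prod.ext (hy d.2.1) rfl))
      right_inv := fun e => by
        refine Prod.ext (Subtype.ext ?_) rfl
        change (e.1.1 ^ p') ^ u * (e.1.1 ^ q') ^ v = e.1.1
        rw [← zpow_natCast, ← zpow_natCast, ← zpow_mul, ← zpow_mul, ← zpow_add, huv, zpow_one] }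
  rw [Nat.card_congr e, Nat.card_prod, Nat.card_fun, Nat.card_fin]
  rfl

lemma numRoots_one_of_isCyclic [Finite U] [IsCyclic U] (k : ℕ) :
    numRoots k (1 : U) = Nat.gcd (Nat.card U) k :=
  IsCyclic.card_powMonoidHom_ker U k

lemma fibreCard_one_of_comm (t p' q' : ℕ) :
    fibreCard t p' q' (1 : U) = numRoots q' (1 : U) * numRoots p' (1 : U) * Nat.card U ^ t := by
  rw [fibreCard, centralizerCard_one]

end Commutative

/-! ### Counting homomorphisms to an affine group -/

/-- The group of the affine maps `x ↦ χ(u) * x + b` of a field, where `u` ranges over the domain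
of a character `χ`. -/
@[ext] structure CharAffine {U F : Type*} [CommGroup U] [Field F] (χ : U →* Fˣ) where
  /-- The linear part. -/
  lin : U
  /-- The translation part. -/
  tr : F

namespace CharAffine

variable {U F : Type*} [CommGroup U] [Field F] {χ : U →* Fˣ}

instance : Mul (CharAffine χ) := ⟨fun x y => ⟨x.lin * y.lin, χ x.lin * y.tr + x.tr⟩⟩
instance : One (CharAffine χ) := ⟨⟨1, 0⟩⟩
instance : Inv (CharAffine χ) := ⟨fun x => ⟨x.lin⁻¹, -(χ x.lin⁻¹ * x.tr)⟩⟩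

@[simp] lemma mul_lin (x y : CharAffine χ) : (x * y).lin = x.lin * y.lin := rfl
@[simp] lemma mul_tr (x y : CharAffine χ) : (x * y).tr = χ x.lin * y.tr + x.tr := rfl
@[simp] lemma one_lin : (1 : CharAffine χ).lin = 1 := rfl
@[simp] lemma one_tr : (1 : CharAffine χ).tr = 0 := rfl
@[simp] lemma inv_lin (x : CharAffine χ) : x⁻¹.lin = x.lin⁻¹ := rfl
@[simp] lemma inv_tr (x : CharAffine χ) : x⁻¹.tr = -(χ x.lin⁻¹ * x.tr) := rfl

instance : Group (CharAffine χ) := Group.ofLeftAxioms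
  (fun x y z => by ext <;> simp [mul_assoc]; ring)
  (fun x => by ext <;> simp)
  (fun x => by ext <;> simp)

/-- An affine map is a pair of a linear part and a translation part. -/
def equivProd : CharAffine χ ≃ U × F where
  toFun x := (x.lin, x.tr)
  invFun x := ⟨x.1, x.2⟩
  left_inv _ := rfl
  right_inv _ := rfl

@[simp] lemma pow_lin (x : CharAffine χ) (k : ℕ) : (x ^ k).lin = x.lin ^ k := by
  induction k with
  | zero => simp
  | succ k ih => rw [pow_succ, mul_lin, ih, pow_succ]

lemma pow_tr (x : CharAffine χ) (k : ℕ) :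
    (x ^ k).tr = (∑ i ∈ Finset.range k, (χ x.lin : F) ^ i) * x.tr := by
  induction k with
  | zero => simp
  | succ k ih =>
    rw [pow_succ, mul_tr, ih, Finset.sum_range_succ, pow_lin, map_pow, Units.val_pow_eq_pow_val]
    ring

lemma coe_char_sub_one_ne_zero (hχ : Function.Injective χ) {u : U} (hu : u ≠ 1) :
    (χ u : F) - 1 ≠ 0 := by
  rw [sub_ne_zero, Ne, Units.val_eq_one]
  exact fun h => hu (hχ (h.trans (map_one χ).symm))

/-- The linear part determines the translation part of a root of an affine map with a nontrivial
linear part, since it has the same unique fixed point. -/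
lemma numRoots_of_ne (hχ : Function.Injective χ) (k : ℕ) {h : CharAffine χ} (hh : h.lin ≠ 1) :
    numRoots k h = numRoots k h.lin := by
  have hgeom (v : U) (hv : v ^ k = h.lin) :
      (∑ i ∈ Finset.range k, (χ v : F) ^ i) ≠ 0 := by
    intro h0
    have := geom_sum_mul (χ v : F) k
    rw [h0, zero_mul, ← Units.val_pow_eq_pow_val, ← map_pow, hv] at this
    exact coe_char_sub_one_ne_zero hχ hh this.symm
  refine Nat.card_eq_of_bijective
    (fun x : {x : CharAffine χ // x ^ k = h} =>
      (⟨x.1.lin, by rw [← pow_lin, x.2]⟩ : {v : U // v ^ k = h.lin})) ⟨?_, ?_⟩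
  · rintro ⟨x, hx⟩ ⟨y, hy⟩ hxy
    have hlin : x.lin = y.lin := congrArg Subtype.val hxy
    refine Subtype.ext (CharAffine.ext hlin ?_)
    have h1 := pow_tr x k
    have h2 := pow_tr y k
    rw [hx] at h1
    rw [hy, ← hlin, h1] at h2
    exact mul_left_cancel₀ (hgeom x.lin (by rw [← pow_lin, hx])) h2
  · rintro ⟨v, hv⟩
    refine ⟨⟨⟨v, (∑ i ∈ Finset.range k, (χ v : F) ^ i)⁻¹ * h.tr⟩, ?_⟩, rfl⟩
    refine CharAffine.ext (by rw [pow_lin, hv]) ?_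
    rw [pow_tr, mul_inv_cancel_left₀ (hgeom v hv)]

lemma centralizerCard_of_ne (hχ : Function.Injective χ) {h : CharAffine χ} (hh : h.lin ≠ 1) :
    centralizerCard h = Nat.card U := by
  have h0 := coe_char_sub_one_ne_zero hχ hh
  refine Nat.card_eq_of_bijective
    (fun x : {x : CharAffine χ // Commute x h} => x.1.lin) ⟨?_, fun v => ?_⟩
  · rintro ⟨x, hx⟩ ⟨y, hy⟩ hlin
    change x.lin = y.lin at hlin
    refine Subtype.ext (CharAffine.ext hlin ?_)
    have h1 := congrArg tr hx.eq
    have h2 := congrArg tr hy.eq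
    rw [mul_tr, mul_tr] at h1 h2
    rw [← hlin] at h2
    refine mul_left_cancel₀ h0 ?_
    linear_combination h2 - h1
  · refine ⟨⟨⟨v, ((χ h.lin : F) - 1)⁻¹ * (((χ v : F) - 1) * h.tr)⟩, ?_⟩, rfl⟩
    refine CharAffine.ext (mul_comm _ _) ?_
    rw [mul_tr, mul_tr]
    have := mul_inv_cancel_left₀ h0 (((χ v : F) - 1) * h.tr)
    linear_combination -this

lemma fibreCard_of_ne (hχ : Function.Injective χ) (t p' q' : ℕ) {h : CharAffine χ}
    (hh : h.lin ≠ 1) : fibreCard t p' q' h = fibreCard t p' q' h.lin := by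
  have : centralizerCard h.lin = Nat.card U :=
    Nat.card_congr (Equiv.subtypeUnivEquiv fun g => Commute.all g _)
  rw [fibreCard, fibreCard, numRoots_of_ne hχ _ hh, numRoots_of_ne hχ _ hh,
    centralizerCard_of_ne hχ hh, this]

lemma numRoots_one [Finite U] [Finite F] (hχ : Function.Injective χ) {k : ℕ}
    (hk : (k : F) ≠ 0) :
    numRoots k (1 : CharAffine χ) = 1 + (numRoots k (1 : U) - 1) * Nat.card F := by
  classical
  have := Fintype.ofFinite U
  have e : {x : CharAffine χ // x ^ k = 1} ≃
      (v : {v : U // v ^ k = 1}) × {b : F // (∑ i ∈ Finset.range k, (χ v.1 : F) ^ i) * b = 0} :=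
    { toFun := fun x => ⟨⟨x.1.lin, by rw [← pow_lin, x.2, one_lin]⟩, x.1.tr,
        by rw [← pow_tr, x.2, one_tr]⟩
      invFun := fun d => ⟨⟨d.1.1, d.2.1⟩, CharAffine.ext (by rw [pow_lin, d.1.2, one_lin])
        (by rw [pow_tr, one_tr, d.2.2])⟩
      left_inv := fun _ => rfl
      right_inv := fun _ => rfl }
  have hcard (v : {v : U // v ^ k = 1}) :
      Nat.card {b : F // (∑ i ∈ Finset.range k, (χ v.1 : F) ^ i) * b = 0} =
        if v = ⟨1, one_pow k⟩ then 1 else Nat.card F := by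
    split_ifs with hv
    · subst hv
      simp [hk]
    · have hv' : v.1 ≠ 1 := fun h => hv (Subtype.ext h)
      have h0 : (∑ i ∈ Finset.range k, (χ v.1 : F) ^ i) = 0 := by
        have := geom_sum_mul (χ v.1 : F) k
        rw [← Units.val_pow_eq_pow_val, ← map_pow, v.2, map_one, Units.val_one, sub_self] at this
        exact (mul_eq_zero.1 this).resolve_right (coe_char_sub_one_ne_zero hχ hv')
      exact Nat.card_congr (Equiv.subtypeUnivEquiv fun b => by rw [h0, zero_mul])
  rw [numRoots, Nat.card_congr e, Nat.card_sigma]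
  simp only [hcard]
  rw [← Finset.add_sum_erase _ _ (Finset.mem_univ (⟨1, one_pow k⟩ : {v : U // v ^ k = 1})),
    if_pos rfl, Finset.sum_congr rfl fun v hv => if_neg (Finset.ne_of_mem_erase hv),
    Finset.sum_const, Finset.card_erase_of_mem (Finset.mem_univ _), Finset.card_univ,
    smul_eq_mul, numRoots, Nat.card_eq_fintype_card (α := {v : U // v ^ k = 1})]

/-- A homomorphism from the amalgam to the affine group either kills the central element `h`, or
maps `h` to a map with a unique fixed point, and then takes values in the stabilizer of this point,
which is isomorphic to `U`. No nontrivial translation satisfies `h ^ m = 1`. -/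
theorem card_amalgamHom [Finite U] [Finite F] (hχ : Function.Injective χ) {t p' q' m : ℕ}
    (hp : (p' : F) ≠ 0) (hq : (q' : F) ≠ 0) (hm : (m : F) ≠ 0) :
    Nat.card (AmalgamHom t p' q' m (CharAffine χ)) +
        Nat.card F * (numRoots q' (1 : U) * numRoots p' (1 : U) * Nat.card U ^ t) =
      (1 + (numRoots q' (1 : U) - 1) * Nat.card F) * (1 + (numRoots p' (1 : U) - 1) * Nat.card F) *
        (Nat.card U * Nat.card F) ^ t + Nat.card F * Nat.card (AmalgamHom t p' q' m U) := by
  classical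
  have := Fintype.ofFinite U
  have := Fintype.ofFinite F
  have := Fintype.ofEquiv _ (equivProd (χ := χ)).symm
  rw [card_amalgamHom_eq_sum, card_amalgamHom_eq_sum (H := U),
    ← (equivProd (χ := χ)).symm.sum_comp, Fintype.sum_prod_type, Finset.mul_sum]
  have hne (u : U) (hu : u ≠ 1) :
      (∑ b : F, if (equivProd (χ := χ)).symm (u, b) ^ m = 1 then
        fibreCard t p' q' ((equivProd (χ := χ)).symm (u, b)) else 0) =
      Nat.card F * if u ^ m = 1 then fibreCard t p' q' u else 0 := by
    rw [Nat.card_eq_fintype_card, ← Finset.card_univ, ← smul_eq_mul, ← Finset.sum_const]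
    refine Finset.sum_congr rfl fun b _ => ?_
    set x := (equivProd (χ := χ)).symm (u, b) with hx
    have hxu : x.lin = u := rfl
    have hiff : x ^ m = 1 ↔ u ^ m = 1 := by
      refine ⟨fun h => by rw [← hxu, ← pow_lin, h, one_lin], fun h => ?_⟩
      refine CharAffine.ext (by rw [pow_lin, hxu, h, one_lin]) ?_
      have h1 := geom_sum_mul (χ u : F) m
      rw [← Units.val_pow_eq_pow_val, ← map_pow, h, map_one, Units.val_one, sub_self] at h1
      rw [pow_tr, hxu, (mul_eq_zero.1 h1).resolve_right (coe_char_sub_one_ne_zero hχ hu),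
        zero_mul, one_tr]
    rw [fibreCard_of_ne hχ t p' q' (h := x) hu, hxu]
    simp only [hiff]
  have hone :
      (∑ b : F, if (equivProd (χ := χ)).symm (1, b) ^ m = 1 then
        fibreCard t p' q' ((equivProd (χ := χ)).symm (1, b)) else 0) =
      fibreCard t p' q' (1 : CharAffine χ) := by
    rw [Finset.sum_eq_single 0]
    · exact if_pos (one_pow m)
    · intro b _ hb
      refine if_neg fun h => ?_
      have h1 := congrArg tr h
      rw [pow_tr] at h1
      simp [equivProd, hm, hb] at h1
    · exact fun h => absurd (Finset.mem_univ _) h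
  rw [← Finset.add_sum_erase _ _ (Finset.mem_univ (1 : U)),
    ← Finset.add_sum_erase (f := fun u : U => Nat.card F * _) _ (Finset.mem_univ (1 : U)), hone,
    Finset.sum_congr rfl fun u hu => hne u (Finset.ne_of_mem_erase hu), one_pow, if_pos rfl,
    fibreCard_one_of_comm, fibreCard, numRoots_one hχ hp, numRoots_one hχ hq, centralizerCard_one,
    Nat.card_congr (equivProd (χ := χ)), Nat.card_prod]
  ring

end CharAffine

/-! ### Numerical invariants -/

section Invariants

variable {t p q m t₁ p₁ q₁ m₁ t₂ p₂ q₂ m₂ : ℕ}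

lemma card_amalgamHom_zmod {K : ℕ} [NeZero K] (hpq : Nat.Coprime p q) :
    Nat.card (AmalgamHom t p q m (Multiplicative (ZMod K))) = Nat.gcd K (p * q * m) * K ^ t := by
  have hK : Nat.card (Multiplicative (ZMod K)) = K := by
    rw [Nat.card_congr Multiplicative.toAdd, Nat.card_zmod]
  rw [card_amalgamHom_of_comm hpq, numRoots_one_of_isCyclic, hK]

/-- The numbers of homomorphisms to finite cyclic groups determine the rank and the order of the
torsion subgroup of the abelianization `ℤ ^ t × ℤ / p q m`. -/
theorem rank_eq_and_torsion_eq (hpq₁ : Nat.Coprime p₁ q₁) (hpq₂ : Nat.Coprime p₂ q₂)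
    (h₁ : 0 < p₁ * q₁ * m₁) (h₂ : 0 < p₂ * q₂ * m₂)
    (h : ∀ (K : ℕ) [NeZero K], Nat.card (AmalgamHom t₁ p₁ q₁ m₁ (Multiplicative (ZMod K))) =
      Nat.card (AmalgamHom t₂ p₂ q₂ m₂ (Multiplicative (ZMod K)))) :
    t₁ = t₂ ∧ p₁ * q₁ * m₁ = p₂ * q₂ * m₂ := by
  replace h (K : ℕ) [NeZero K] :
      Nat.gcd K (p₁ * q₁ * m₁) * K ^ t₁ = Nat.gcd K (p₂ * q₂ * m₂) * K ^ t₂ :=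
    (card_amalgamHom_zmod hpq₁).symm.trans ((h K).trans (card_amalgamHom_zmod hpq₂))
  have ht : t₁ = t₂ := by
    -- A prime exceeding both torsion orders only sees the rank.
    obtain ⟨l, hl, hlp⟩ := Nat.exists_infinite_primes (p₁ * q₁ * m₁ + p₂ * q₂ * m₂ + 1)
    have : NeZero l := ⟨hlp.ne_zero⟩
    have hl₁ : Nat.gcd l (p₁ * q₁ * m₁) = 1 :=
      (hlp.coprime_iff_not_dvd).2 fun hd => by have := Nat.le_of_dvd h₁ hd; omega
    have hl₂ : Nat.gcd l (p₂ * q₂ * m₂) = 1 :=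
      (hlp.coprime_iff_not_dvd).2 fun hd => by have := Nat.le_of_dvd h₂ hd; omega
    have := h l
    rw [hl₁, hl₂, one_mul, one_mul] at this
    exact Nat.pow_right_injective hlp.two_le this
  subst ht
  have hgcd (K : ℕ) (hK : 0 < K) : Nat.gcd K (p₁ * q₁ * m₁) = Nat.gcd K (p₂ * q₂ * m₂) := by
    have : NeZero K := ⟨hK.ne'⟩
    exact Nat.eq_of_mul_eq_mul_right (pow_pos hK _) (h K)
  refine ⟨rfl, Nat.dvd_antisymm ?_ ?_⟩
  · have := hgcd _ h₁
    rw [Nat.gcd_self] at this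
    exact this ▸ Nat.gcd_dvd_right _ _
  · have := hgcd _ h₂
    rw [Nat.gcd_self] at this
    exact this.symm ▸ Nat.gcd_dvd_right _ _

lemma natCast_zmod_ne_zero {k l : ℕ} (hk : 0 < k) (hkl : k < l) : (k : ZMod l) ≠ 0 := by
  rw [Ne, ZMod.natCast_eq_zero_iff]
  exact fun hd => absurd (Nat.le_of_dvd hk hd) (by omega)

/-- The group of affine maps of `ℤ / l` whose linear part is a `K`-th root of unity. -/
abbrev RootAffine (K l : ℕ) [Fact l.Prime] : Type :=
  CharAffine (rootsOfUnity K (ZMod l)).subtype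

lemma card_amalgamHom_rootAffine {K l : ℕ} [hl : Fact l.Prime] (hKl : K ∣ l - 1)
    (hpq : Nat.Coprime p q) (hp : 0 < p) (hq : 0 < q) (hm : 0 < m) (hpl : p < l) (hql : q < l)
    (hml : m < l) :
    Nat.card (AmalgamHom t p q m (RootAffine K l)) +
        l * (Nat.gcd K q * Nat.gcd K p * K ^ t) =
      (1 + (Nat.gcd K q - 1) * l) * (1 + (Nat.gcd K p - 1) * l) * (K * l) ^ t +
        l * (Nat.gcd K (p * q * m) * K ^ t) := by
  have hK : Nat.card (rootsOfUnity K (ZMod l)) = K := by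
    have h1 := IsCyclic.card_powMonoidHom_ker (ZMod l)ˣ K
    rw [Nat.card_eq_fintype_card (α := (ZMod l)ˣ), ZMod.card_units_eq_totient,
      Nat.totient_prime hl.out, Nat.gcd_eq_right hKl] at h1
    exact h1
  have : NeZero K := ⟨by
    rintro rfl
    have := hl.out.two_le
    have := Nat.eq_zero_of_zero_dvd hKl
    omega⟩
  have h := CharAffine.card_amalgamHom (χ := (rootsOfUnity K (ZMod l)).subtype)
    (Subgroup.subtype_injective _) (t := t) (natCast_zmod_ne_zero hp hpl)
    (natCast_zmod_ne_zero hq hql) (natCast_zmod_ne_zero hm hml)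
  rwa [card_amalgamHom_of_comm hpq, numRoots_one_of_isCyclic, numRoots_one_of_isCyclic,
    numRoots_one_of_isCyclic, hK, Nat.card_zmod] at h

/-- For equal rank and torsion of the abelianization, the counts of homomorphisms to an affine group
can be compared after cancelling `K ^ t` and the terms that depend only on the abelianization. -/
lemma affine_count_eq (hpq₁ : Nat.Coprime p₁ q₁) (hpq₂ : Nat.Coprime p₂ q₂)
    (h₁ : 0 < p₁ * q₁ * m₁) (hN : p₁ * q₁ * m₁ = p₂ * q₂ * m₂)
    (h : ∀ (K l : ℕ) [Fact l.Prime], Nat.card (AmalgamHom t p₁ q₁ m₁ (RootAffine K l)) =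
      Nat.card (AmalgamHom t p₂ q₂ m₂ (RootAffine K l)))
    {K : ℕ} (hK : 0 < K) :
    ∃ l : ℕ, p₁ * q₁ * m₁ < l ∧ ∀ a₁ b₁ a₂ b₂ : ℤ,
      a₁ = Nat.gcd K q₁ → b₁ = Nat.gcd K p₁ → a₂ = Nat.gcd K q₂ → b₂ = Nat.gcd K p₂ →
      (1 + (a₁ - 1) * l) * (1 + (b₁ - 1) * l) * (l : ℤ) ^ t - l * (a₁ * b₁) =
        (1 + (a₂ - 1) * l) * (1 + (b₂ - 1) * l) * (l : ℤ) ^ t - l * (a₂ * b₂) := by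
  obtain ⟨l, hlp, hl, hlK⟩ := Nat.exists_prime_gt_modEq_one (p₁ * q₁ * m₁) hK.ne'
  have : Fact l.Prime := ⟨hlp⟩
  have hKl : K ∣ l - 1 := (Nat.modEq_iff_dvd' hlp.one_le).1 hlK.symm
  refine ⟨l, hl, ?_⟩
  have hle {p q m : ℕ} (h0 : 0 < p * q * m) (hlt : p * q * m < l) :
      0 < p ∧ 0 < q ∧ 0 < m ∧ p < l ∧ q < l ∧ m < l := by
    have hm : 0 < m := Nat.pos_of_mul_pos_left h0
    have hpq : 0 < p * q := Nat.pos_of_mul_pos_right h0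
    have hp : 0 < p := Nat.pos_of_mul_pos_right hpq
    have hq : 0 < q := Nat.pos_of_mul_pos_left hpq
    have h1 : p * q ≤ p * q * m := Nat.le_mul_of_pos_right _ hm
    have h2 : p ≤ p * q := Nat.le_mul_of_pos_right _ hq
    have h3 : q ≤ p * q := Nat.le_mul_of_pos_left _ hp
    have h4 : m ≤ p * q * m := Nat.le_mul_of_pos_left _ hpq
    omega
  obtain ⟨hp, hq, hm, hpl, hql, hml⟩ := hle h₁ hl
  obtain ⟨hp', hq', hm', hpl', hql', hml'⟩ := hle (hN ▸ h₁) (hN ▸ hl)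
  have e₁ := card_amalgamHom_rootAffine (t := t) hKl hpq₁ hp hq hm hpl hql hml
  have e₂ := card_amalgamHom_rootAffine (t := t) hKl hpq₂ hp' hq' hm' hpl' hql' hml'
  rw [h K l] at e₁
  rw [← hN] at e₂
  have hc {k : ℕ} (hk : 0 < k) : ((Nat.gcd K k - 1 : ℕ) : ℤ) = (Nat.gcd K k : ℤ) - 1 := by
    rw [Nat.cast_sub (Nat.gcd_pos_of_pos_right K hk), Nat.cast_one]
  zify at e₁ e₂
  rw [hc hp, hc hq] at e₁
  rw [hc hp', hc hq'] at e₂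
  rintro a₁ b₁ a₂ b₂ rfl rfl rfl rfl
  have hKt : (K : ℤ) ^ t ≠ 0 := by positivity
  refine mul_left_cancel₀ hKt ?_
  rw [mul_pow] at e₁ e₂
  linear_combination e₂ - e₁

lemma eq_of_mul_eq_of_add_eq (hle₁ : q₁ ≤ p₁) (hle₂ : q₂ ≤ p₂) (hmul : p₁ * q₁ = p₂ * q₂)
    (hadd : p₁ + q₁ = p₂ + q₂) : p₁ = p₂ ∧ q₁ = q₂ := by
  zify at hmul hadd
  have h : ((p₁ : ℤ) - p₂) * (p₁ - q₂) = 0 := by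
    linear_combination (p₁ : ℤ) * hadd - hmul
  rcases mul_eq_zero.1 h with h | h <;> omega

/-- For positive rank, counting homomorphisms to one affine group suffices: modulo `l` the count
yields `p q`, and then `p + q`. -/
lemma mul_eq_and_add_eq_of_rank_pos (ht : 0 < t) (hpq₁ : Nat.Coprime p₁ q₁)
    (hpq₂ : Nat.Coprime p₂ q₂) (h₁ : 0 < p₁ * q₁ * m₁) (hN : p₁ * q₁ * m₁ = p₂ * q₂ * m₂)
    (h : ∀ (K l : ℕ) [Fact l.Prime], Nat.card (AmalgamHom t p₁ q₁ m₁ (RootAffine K l)) =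
      Nat.card (AmalgamHom t p₂ q₂ m₂ (RootAffine K l))) :
    p₁ * q₁ = p₂ * q₂ ∧ p₁ + q₁ = p₂ + q₂ := by
  obtain ⟨l, hl, hcount⟩ := affine_count_eq hpq₁ hpq₂ h₁ hN h h₁
  have key := hcount q₁ p₁ q₂ p₂
    (by rw [Nat.gcd_eq_right ⟨p₁ * m₁, by ring⟩])
    (by rw [Nat.gcd_eq_right ⟨q₁ * m₁, by ring⟩])
    (by rw [hN, Nat.gcd_eq_right ⟨p₂ * m₂, by ring⟩])
    (by rw [hN, Nat.gcd_eq_right ⟨q₂ * m₂, by ring⟩])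
  obtain ⟨k, rfl⟩ := Nat.exists_eq_add_of_lt ht
  rw [zero_add, pow_succ] at key
  have hl0 : (l : ℤ) ≠ 0 := by omega
  -- Cancelling `l` leaves a multiple of `l` on the left; the right-hand side is smaller than `l` in
  -- absolute value, so it vanishes.
  have key' : (l : ℤ) ^ k * l * (((p₁ + q₁ : ℤ) - (p₂ + q₂)) * (1 - l) +
      l * (p₁ * q₁ - p₂ * q₂)) = (p₁ * q₁ - p₂ * q₂ : ℤ) := by
    refine mul_left_cancel₀ hl0 ?_
    linear_combination key
  have hle₁ : p₁ * q₁ ≤ p₁ * q₁ * m₁ :=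
    Nat.le_mul_of_pos_right _ (Nat.pos_of_mul_pos_left h₁)
  have hle₂ : p₂ * q₂ ≤ p₁ * q₁ * m₁ := by
    rw [hN]
    exact Nat.le_mul_of_pos_right _ (Nat.pos_of_mul_pos_left (hN ▸ h₁))
  have hmul : (p₁ * q₁ - p₂ * q₂ : ℤ) = 0 := by
    have hdvd : (l : ℤ) ∣ p₁ * q₁ - p₂ * q₂ := by
      rw [← key', mul_assoc]
      exact (dvd_mul_right _ _).mul_left _
    refine Int.eq_zero_of_abs_lt_dvd hdvd ?_
    rw [abs_lt]
    zify at hle₁ hle₂ hl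
    have : (0 : ℤ) ≤ p₁ * q₁ := by positivity
    have : (0 : ℤ) ≤ p₂ * q₂ := by positivity
    constructor <;> linarith
  have hl1 : (1 - l : ℤ) ≠ 0 := by omega
  rw [hmul, mul_zero, add_zero] at key'
  have hadd : (p₁ + q₁ : ℤ) - (p₂ + q₂) = 0 := by
    have h0 : (l : ℤ) ^ k * l ≠ 0 := by positivity
    exact (mul_eq_zero.1 ((mul_eq_zero.1 key').resolve_left h0)).resolve_right hl1
  constructor
  · zify; linarith
  · zify; linarith

/-- For rank zero, the count yields the numbers `(gcd (K, p) - 1) * (gcd (K, q) - 1)`. For `p`, `q`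
different from `1`, the maximum of these is `(p - 1) * (q - 1)`, and it is attained exactly at the
multiples `K` of `p q`. -/
lemma mul_eq_and_add_eq_of_rank_zero (hpq₁ : Nat.Coprime p₁ q₁)
    (hpq₂ : Nat.Coprime p₂ q₂) (hp₁ : 2 ≤ p₁) (hq₁ : 2 ≤ q₁) (hp₂ : 2 ≤ p₂) (hq₂ : 2 ≤ q₂)
    (h₁ : 0 < p₁ * q₁ * m₁) (hN : p₁ * q₁ * m₁ = p₂ * q₂ * m₂)
    (h : ∀ (K l : ℕ) [Fact l.Prime], Nat.card (AmalgamHom 0 p₁ q₁ m₁ (RootAffine K l)) =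
      Nat.card (AmalgamHom 0 p₂ q₂ m₂ (RootAffine K l))) :
    p₁ * q₁ = p₂ * q₂ ∧ p₁ + q₁ = p₂ + q₂ := by
  have hcount {K : ℕ} (hK : 0 < K) :
      ((Nat.gcd K q₁ : ℤ) - 1) * (Nat.gcd K p₁ - 1) =
        ((Nat.gcd K q₂ : ℤ) - 1) * (Nat.gcd K p₂ - 1) := by
    obtain ⟨l, hl, hcount⟩ := affine_count_eq hpq₁ hpq₂ h₁ hN h hK
    have key := hcount _ _ _ _ rfl rfl rfl rfl
    have hl1 : 1 < l := by omega
    have h0 : (l : ℤ) * (l - 1) ≠ 0 := mul_ne_zero (by omega) (by omega)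
    refine mul_left_cancel₀ h0 ?_
    linear_combination key
  have hbound {a b c d : ℤ} (ha : 0 ≤ a) (hb : 0 ≤ b) (hac : a ≤ c) (hbd : b ≤ d) (hc : 0 < c)
      (hd : 0 < d) (hcd : c * d ≤ a * b) : a = c ∧ b = d := by
    constructor
    · by_contra hne
      have : a < c := lt_of_le_of_ne hac hne
      nlinarith
    · by_contra hne
      have : b < d := lt_of_le_of_ne hbd hne
      nlinarith
  have hg {K k : ℕ} (hk : 2 ≤ k) : (0 : ℤ) ≤ (Nat.gcd K k : ℤ) - 1 ∧
      (Nat.gcd K k : ℤ) - 1 ≤ (k : ℤ) - 1 := by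
    have h1 : 0 < Nat.gcd K k := Nat.gcd_pos_of_pos_right K (by omega)
    have h2 : Nat.gcd K k ≤ k := Nat.gcd_le_right K (by omega)
    omega
  have c₁ := hcount (K := p₁ * q₁) (by positivity)
  have c₂ := hcount (K := p₂ * q₂) (by positivity)
  rw [Nat.gcd_mul_left_left, Nat.gcd_mul_right_left] at c₁ c₂
  have g1 := hg (K := p₁ * q₁) hq₂
  have g2 := hg (K := p₁ * q₁) hp₂
  have g3 := hg (K := p₂ * q₂) hq₁
  have g4 := hg (K := p₂ * q₂) hp₁
  have le1 : ((q₁ : ℤ) - 1) * (p₁ - 1) ≤ ((q₂ : ℤ) - 1) * (p₂ - 1) := by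
    rw [c₁]
    exact mul_le_mul g1.2 g2.2 g2.1 (by omega)
  have le2 : ((q₂ : ℤ) - 1) * (p₂ - 1) ≤ ((q₁ : ℤ) - 1) * (p₁ - 1) := by
    rw [← c₂]
    exact mul_le_mul g3.2 g4.2 g4.1 (by omega)
  obtain ⟨d1, d2⟩ := hbound g1.1 g2.1 g1.2 g2.2 (by omega) (by omega) (by rw [← c₁]; exact le2)
  obtain ⟨d3, d4⟩ := hbound g3.1 g4.1 g3.2 g4.2 (by omega) (by omega) (by rw [c₂]; exact le1)
  have hmul : p₁ * q₁ = p₂ * q₂ := by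
    refine Nat.dvd_antisymm (hpq₁.mul_dvd_of_dvd_of_dvd ?_ ?_) (hpq₂.mul_dvd_of_dvd_of_dvd ?_ ?_)
    · exact Nat.gcd_eq_right_iff_dvd.1 (by omega)
    · exact Nat.gcd_eq_right_iff_dvd.1 (by omega)
    · exact Nat.gcd_eq_right_iff_dvd.1 (by omega)
    · exact Nat.gcd_eq_right_iff_dvd.1 (by omega)
  refine ⟨hmul, ?_⟩
  have heq := le_antisymm le1 le2
  zify at hmul ⊢
  linear_combination hmul - heq

end Invariants

/-! ### Normalized triples -/

/-- A normalized triple is described by the rank `t` of the abelianization, the coprime orders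
`p' ≥ q'` of the elliptic generators, and the order `m` of the central element
`A p ^ q' = A q ^ p'`. -/
lemma OkaNormalized.exists_eq {p q r : ℕ} (h : OkaNormalized p q r) :
    ∃ t p' q' m : ℕ, p = (t + 1) * p' ∧ q = (t + 1) * q' ∧ r = m * q' ∧ Nat.Coprime p' q' ∧
      0 < q' ∧ q' ≤ p' ∧ 0 < m := by
  obtain ⟨hp, hq, hr, hqp, m, hm⟩ := h
  have hs : 0 < Nat.gcd p q := Nat.gcd_pos_of_pos_left q hp
  have hq' : 0 < q / Nat.gcd p q := Nat.div_pos (Nat.gcd_le_right p hq) hs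
  refine ⟨Nat.gcd p q - 1, p / Nat.gcd p q, q / Nat.gcd p q, m, ?_, ?_, by rw [hm, mul_comm],
    Nat.coprime_div_gcd_div_gcd hs, hq', Nat.div_le_div_right hqp, ?_⟩
  · rw [Nat.sub_add_cancel hs, Nat.mul_div_cancel' (Nat.gcd_dvd_left p q)]
  · rw [Nat.sub_add_cancel hs, Nat.mul_div_cancel' (Nat.gcd_dvd_right p q)]
  · exact Nat.pos_of_mul_pos_left (hm ▸ hr)

lemma okaNormalized_of_coprime {s p' q' m : ℕ} (hs : 0 < s) (hq : 0 < q') (hm : 0 < m)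
    (hpq : Nat.Coprime p' q') (hle : q' ≤ p') :
    OkaNormalized (s * p') (s * q') (m * q') := by
  have hp : 0 < p' := hq.trans_le hle
  refine ⟨Nat.mul_pos hs hp, Nat.mul_pos hs hq, Nat.mul_pos hm hq, Nat.mul_le_mul_left s hle, ?_⟩
  rw [Nat.gcd_mul_left, hpq.gcd_eq_one, mul_one, Nat.mul_div_cancel_left _ hs]
  exact Dvd.intro_left m rfl

/-- In the notation of `OkaNormalized.exists_eq`, the numbers of homomorphisms to finite groups
determine `t`, `p' * q' * m`, `p' * q'` and `p' + q'`. For `t = 0` and `q' = 1` the group is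
finite cyclic. -/
theorem OkaNormalized.eq_of_mulEquiv {p₁ q₁ r₁ p₂ q₂ r₂ : ℕ} (h₁ : OkaNormalized p₁ q₁ r₁)
    (h₂ : OkaNormalized p₂ q₂ r₂) (e : OkaGroup p₁ q₁ r₁ ≃* OkaGroup p₂ q₂ r₂)
    (hcyc : ¬ (Finite (OkaGroup p₁ q₁ r₁) ∧ IsCyclic (OkaGroup p₁ q₁ r₁))) :
    p₁ = p₂ ∧ q₁ = q₂ ∧ r₁ = r₂ := by
  have hcyc' : ¬ (Finite (OkaGroup p₂ q₂ r₂) ∧ IsCyclic (OkaGroup p₂ q₂ r₂)) := by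
    rintro ⟨hf, hc⟩
    exact hcyc ⟨Finite.of_equiv _ e.symm.toEquiv,
      isCyclic_of_surjective e.symm.toMonoidHom e.symm.surjective⟩
  obtain ⟨t₁, a₁, b₁, m₁, rfl, rfl, rfl, hab₁, hb₁, hle₁, hm₁⟩ := h₁.exists_eq
  obtain ⟨t₂, a₂, b₂, m₂, rfl, rfl, rfl, hab₂, hb₂, hle₂, hm₂⟩ := h₂.exists_eq
  have ha₁ : 0 < a₁ := hb₁.trans_le hle₁
  have ha₂ : 0 < a₂ := hb₂.trans_le hle₂
  have hcard (H : Type) [Group H] :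
      Nat.card (AmalgamHom t₁ a₁ b₁ m₁ H) = Nat.card (AmalgamHom t₂ a₂ b₂ m₂ H) := by
    rw [← card_hom_eq_card_amalgamHom hab₁, ← card_hom_eq_card_amalgamHom hab₂]
    exact Nat.card_congr
      { toFun := fun φ => φ.comp e.symm.toMonoidHom
        invFun := fun ψ => ψ.comp e.toMonoidHom
        left_inv := fun φ => by ext x; simp
        right_inv := fun ψ => by ext x; simp }
  have hN₁ : 0 < a₁ * b₁ * m₁ := by positivity
  have hN₂ : 0 < a₂ * b₂ * m₂ := by positivity
  obtain ⟨rfl, hN⟩ := rank_eq_and_torsion_eq hab₁ hab₂ hN₁ hN₂ fun K _ => hcard _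
  have hmain : a₁ * b₁ = a₂ * b₂ ∧ a₁ + b₁ = a₂ + b₂ := by
    rcases Nat.eq_zero_or_pos t₁ with rfl | ht
    · have hne₁ : b₁ ≠ 1 := by
        rintro rfl
        exact hcyc (OkaGroup.finite_and_isCyclic_of_one (by positivity) (by positivity))
      have hne₂ : b₂ ≠ 1 := by
        rintro rfl
        exact hcyc' (OkaGroup.finite_and_isCyclic_of_one (by positivity) (by positivity))
      exact mul_eq_and_add_eq_of_rank_zero hab₁ hab₂ (by omega) (by omega) (by omega) (by omega)
        hN₁ hN fun K l _ => hcard _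
    · exact mul_eq_and_add_eq_of_rank_pos ht hab₁ hab₂ hN₁ hN fun K l _ => hcard _
  obtain ⟨rfl, rfl⟩ := eq_of_mul_eq_of_add_eq hle₁ hle₂ hmain.1 hmain.2
  have hm : m₁ = m₂ := Nat.eq_of_mul_eq_mul_left (Nat.mul_pos ha₁ hb₁) hN
  exact ⟨rfl, rfl, by rw [hm]⟩

theorem mainTheorem5 (p q r s a : ℕ) (hp : 0 < p) (hq : 0 < q) (hr : 0 < r)
    (hs : s = Nat.gcd p q) (ha : a = Nat.gcd (q / s) r) :
    Nonempty (OkaGroup p q r ≃* OkaGroup p (a * s) r) ∧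
    Nonempty (OkaGroup p (a * s) r ≃* OkaGroup (a * s) p ((r / a) * (p / s))) ∧
    (∃ p' q' r' : ℕ,
      ((p', q', r') = (p, a * s, r) ∨ (p', q', r') = (a * s, p, (r / a) * (p / s))) ∧
      OkaNormalized p' q' r' ∧ Nonempty (OkaGroup p q r ≃* OkaGroup p' q' r')) ∧
    (¬ (Finite (OkaGroup p q r) ∧ IsCyclic (OkaGroup p q r)) →
      ∃! t : ℕ × ℕ × ℕ,
        OkaNormalized t.1 t.2.1 t.2.2 ∧
          Nonempty (OkaGroup p q r ≃* OkaGroup t.1 t.2.1 t.2.2)) := by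
  have hs0 : 0 < s := hs ▸ Nat.gcd_pos_of_pos_left q hp
  have ha0 : 0 < a := ha ▸ Nat.gcd_pos_of_pos_right _ hr
  have hps : p = s * (p / s) := (Nat.mul_div_cancel' (hs ▸ Nat.gcd_dvd_left p q)).symm
  have hqs : q = s * (q / s) := (Nat.mul_div_cancel' (hs ▸ Nat.gcd_dvd_right p q)).symm
  have hra : r = r / a * a := (Nat.div_mul_cancel (ha ▸ Nat.gcd_dvd_right _ _)).symm
  have hpq : Nat.Coprime (p / s) (q / s) := by
    rw [hs]
    exact Nat.coprime_div_gcd_div_gcd (hs ▸ hs0)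
  have hpa : Nat.Coprime (p / s) a :=
    Nat.Coprime.coprime_dvd_right (ha ▸ Nat.gcd_dvd_left _ _) hpq
  have hp0 : 0 < p / s := Nat.pos_of_mul_pos_left (hps ▸ hp)
  have hr0 : 0 < r / a := Nat.pos_of_mul_pos_right (hra ▸ hr)
  obtain ⟨e₁⟩ := OkaGroup.nonempty_mulEquiv_gcd (r := r) hps hqs hpq ha
  obtain ⟨e₂⟩ := OkaGroup.nonempty_mulEquiv_swap hps (mul_comm a s) hra
  have hex : ∃ p' q' r' : ℕ,
      ((p', q', r') = (p, a * s, r) ∨ (p', q', r') = (a * s, p, (r / a) * (p / s))) ∧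
      OkaNormalized p' q' r' ∧ Nonempty (OkaGroup p q r ≃* OkaGroup p' q' r') := by
    rcases le_total a (p / s) with hle | hle
    · refine ⟨p, a * s, r, Or.inl rfl, ?_, ⟨e₁⟩⟩
      have := okaNormalized_of_coprime hs0 ha0 hr0 hpa hle
      rwa [← hps, ← hra, mul_comm s a] at this
    · refine ⟨a * s, p, _, Or.inr rfl, ?_, ⟨e₁.trans e₂⟩⟩
      have := okaNormalized_of_coprime hs0 hp0 hr0 hpa.symm hle
      rwa [← hps, mul_comm s a] at this
  refine ⟨⟨e₁⟩, ⟨e₂⟩, hex, fun hcyc => ?_⟩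
  obtain ⟨p', q', r', -, hn, ⟨e⟩⟩ := hex
  refine ⟨(p', q', r'), ⟨hn, ⟨e⟩⟩, ?_⟩
  rintro ⟨p₂, q₂, r₂⟩ ⟨hn₂, ⟨f⟩⟩
  have hcyc' : ¬ (Finite (OkaGroup p₂ q₂ r₂) ∧ IsCyclic (OkaGroup p₂ q₂ r₂)) := by
    rintro ⟨hf, hc⟩
    exact hcyc ⟨Finite.of_equiv _ f.symm.toEquiv,
      isCyclic_of_surjective f.symm.toMonoidHom f.symm.surjective⟩
  obtain ⟨rfl, rfl, rfl⟩ := hn₂.eq_of_mulEquiv hn (f.symm.trans e) hcyc'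
  rfl
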